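/- Let $T, r \ge 0$ be integers and $I=\{0,1,\dots,T\}$. For a Polish space $U$ let $\mathcal S(U)$ be the collection of adapted processes $\mathbf X=(\Omega,\mathbb P,(\mathcal F_t)_{t\in I},X)$ with state space $U$: a filtered probability space (which may vary with $\mathbf X$) and maps $X_t:\Omega\to U$, $t\in I$, with $X_t$ $\mathcal F_t$-measurable. The *adapted functionals* are defined inductively: (i) $\mathbf X\mapsto g(X_{t_1},\dots,X_{t_n})$ with $t_i\in I$ and $g\in C_b(U^n,\mathbb R)$, of rank $0$; (ii) $\mathbf X\mapsto g(f_1(\mathbf X),\dots,f_n(\mathbf X))$ with adapted functionals $f_i$ and $g\in C_b(\mathbb R^n,\mathbb R)$, of rank $\max_i \operatorname{rank} f_i$; (iii) $\mathbf X\mapsto \mathbb E[f(\mathbf X)\mid\mathcal F_t]$ with an adapted functional $f$ and $t\in I$, of rank $\operatorname{rank} f+1$. The *adapted topology of rank $r$*, $\tau_r$, is the initial topology on $\mathcal S(U)$ of the maps $\mathbf X\mapsto\mathbb E[f(\mathbf X)]$, $f$ an adapted functional of rank at most $r$; thus $\mathbf X^n\to\mathbf X$ in $\tau_r$ if and only if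 $\mathbb E[f(\mathbf X^n)]\to\mathbb E[f(\mathbf X)]$ for all such $f$. Put $U_0=U$ and let $U_{k+1}$ be the space of Borel probability measures on $U_k^I$ with the topology of weak convergence. The *prediction processes* of $\mathbf X$ are $\hat X^0=X$ and $\hat X^{k+1}_t=\mathbb P(\hat X^k\in\cdot\mid\mathcal F_t)$ (regular conditional law of the whole path $\hat X^k=(\hat X^k_s)_{s\in I}$), $t\in I$, so that $\hat X^k$ has state space $U_k$. The *extended weak topology of rank $r$*, $\hat\tau_r$, is the initial topology on $\mathcal S(U)$ of the maps $\mathbf X\mapsto\mathbb E[f(\hat X^r)]$, $f\in C_b(U_r^I,\mathbb R)$; thus $\mathbf X^n\to\mathbf X$ in $\hat\tau_r$ if and only if the paths of their rank $r$ prediction processes converge in law. Let $V$ be a separable Banach space. Then $\tau_r\subset\hat\tau_r$ on $\mathcal S(V)$; in particular, every sequence that converges to $\mathbf X$ in $(\mathcal S(V),\hat\tau_r)$ converges to $\mathbf X$ in $(\mathcal S(V),\tau_r)$. Moreover, for every compact $K\subset V$, $\tau_r=\hat\tau_r$ on $\mathcal S(K)$; in particular, the two topologies have the same convergent sequences with the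 same limits. -/

import Mathlib

open MeasureTheory ProbabilityTheory Filter Topology TopologicalSpace
open scoped BoundedContinuousFunction

universe u v

/-! ### Spaces of probability measures

For a separable metrizable Borel space `X`, the space `ProbabilityMeasure X` with the topology of
weak convergence is again separable metrizable, its Borel σ-algebra is the one generated by the
evaluations `μ ↦ μ s`, and it is standard Borel if `X` is. -/

section ProbabilityMeasureSpaces

theorem mem_nhds_generateFrom {α : Type*} {g : Set (Set α)} {s : Set α} (hs : s ∈ g) {a : α}
    (ha : a ∈ s) : s ∈ @nhds α (generateFrom g) a := by
  let := generateFrom g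
  exact (isOpen_generateFrom_of_mem hs).mem_nhds ha

variable {X : Type*} [TopologicalSpace X] [MeasurableSpace X]

theorem isInducing_probabilityMeasure_map {K : Type*} [TopologicalSpace K] [MeasurableSpace K]
    [SecondCountableTopology X] [MetrizableSpace X] [BorelSpace X]
    [SecondCountableTopology K] [MetrizableSpace K] [BorelSpace K]
    {e : X → K} (he : IsInducing e) :
    IsInducing (fun μ : ProbabilityMeasure X =>
      μ.map he.continuous.measurable.aemeasurable) := by
  rw [isInducing_iff_nhds]
  intro μ
  refine le_antisymm ?_ ?_
  · rw [← tendsto_iff_comap]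
    exact (ProbabilityMeasure.continuous_map he.continuous).continuousAt
  · refine tendsto_id'.1 ?_
    refine tendsto_of_forall_isOpen_le_liminf' (μs := id) fun G hG => ?_
    obtain ⟨W, hW, rfl⟩ := he.isOpen_iff.1 hG
    have h := ProbabilityMeasure.le_liminf_measure_open_of_tendsto
      (tendsto_comap : Tendsto (fun μ : ProbabilityMeasure X =>
        μ.map he.continuous.measurable.aemeasurable) (comap _
          (𝓝 (μ.map he.continuous.measurable.aemeasurable))) _) hW
    simpa [ProbabilityMeasure.toMeasure_map,
      Measure.map_apply he.continuous.measurable hW.measurableSet] using h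

instance instSecondCountableProbabilityMeasure [SecondCountableTopology X] [MetrizableSpace X]
    [BorelSpace X] : SecondCountableTopology (ProbabilityMeasure X) := by
  let := metrizableSpaceMetric X
  obtain ⟨e, he⟩ := Metric.PiNatEmbed.exists_embedding_to_hilbert_cube (X := X)
  let := metrizableSpaceMetric (ProbabilityMeasure (ℕ → unitInterval))
  exact (isInducing_probabilityMeasure_map he.isInducing).secondCountableTopology

theorem measurable_probabilityMeasure_apply_of_isOpen [SecondCountableTopology X]
    [MetrizableSpace X] [BorelSpace X] {G : Set X} (hG : IsOpen G) :
    Measurable[borel (ProbabilityMeasure X)]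
      (fun μ : ProbabilityMeasure X => (μ : Measure X) G) := by
  let : MeasurableSpace (ProbabilityMeasure X) := borel _
  have : BorelSpace (ProbabilityMeasure X) := ⟨rfl⟩
  refine LowerSemicontinuous.measurable ?_
  rw [lowerSemicontinuous_iff_le_liminf]
  intro μ
  exact ProbabilityMeasure.le_liminf_measure_open_of_tendsto tendsto_id hG

instance instBorelSpaceProbabilityMeasure [SecondCountableTopology X] [MetrizableSpace X]
    [BorelSpace X] : BorelSpace (ProbabilityMeasure X) := by
  refine ⟨le_antisymm ?_ ?_⟩
  · have h : Measurable[borel (ProbabilityMeasure X)]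
        (fun μ : ProbabilityMeasure X => (μ : Measure X)) := by
      refine @Measurable.measure_of_isPiSystem_of_isProbabilityMeasure _ _ (borel _) _ _ _
        {s : Set X | IsOpen s} (BorelSpace.measurable_eq) isPiSystem_isOpen ?_
      intro s hs
      exact measurable_probabilityMeasure_apply_of_isOpen hs
    exact measurable_iff_comap_le.1 h
  · have hsub : (inferInstance : TopologicalSpace (ProbabilityMeasure X)) =
        generateFrom {S | ∃ f : X →ᵇ ℝ, ∃ V : Set ℝ, IsOpen V ∧
          S = (fun μ : ProbabilityMeasure X => ∫ x, f x ∂(μ : Measure X)) ⁻¹' V} := by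
      refine le_antisymm (le_generateFrom ?_) ?_
      · rintro S ⟨f, V, hV, rfl⟩
        exact hV.preimage (ProbabilityMeasure.continuous_integral_boundedContinuousFunction f)
      · refine le_of_nhds_le_nhds fun μ => tendsto_id'.1 ?_
        refine ProbabilityMeasure.tendsto_iff_forall_integral_tendsto.2 fun f => ?_
        refine tendsto_nhds.2 fun V hV hμ => ?_
        exact mem_nhds_generateFrom (by exact ⟨f, V, hV, rfl⟩) hμ
    rw [borel_eq_generateFrom_of_subbasis hsub]
    refine MeasurableSpace.generateFrom_le ?_
    rintro S ⟨f, V, hV, rfl⟩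
    have hm : Measurable (fun μ : ProbabilityMeasure X => ∫ x, f x ∂(μ : Measure X)) := by
      let κ : Kernel (ProbabilityMeasure X) X := ⟨fun μ => (μ : Measure X), measurable_subtype_coe⟩
      have : IsMarkovKernel κ := ⟨fun μ => inferInstanceAs (IsProbabilityMeasure (μ : Measure X))⟩
      exact (StronglyMeasurable.integral_kernel (κ := κ)
        f.continuous.stronglyMeasurable).measurable
    exact hm hV.measurableSet

theorem standardBorelSpace_of_measurableEquiv {α β : Type*} [MeasurableSpace α]
    [MeasurableSpace β] [StandardBorelSpace β] (φ : α ≃ᵐ β) : StandardBorelSpace α := by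
  let := upgradeStandardBorel β
  let t : TopologicalSpace α := TopologicalSpace.induced φ inferInstance
  refine ⟨t, ⟨?_⟩, φ.toEquiv.polishSpace_induced⟩
  rw [borel_comap, ← BorelSpace.measurable_eq (α := β)]
  refine le_antisymm ?_ φ.measurable.comap_le
  intro s hs
  refine ⟨φ.symm ⁻¹' s, φ.symm.measurable hs, ?_⟩
  ext x
  simp

instance instStandardBorelProbabilityMeasure {X : Type*} [MeasurableSpace X]
    [StandardBorelSpace X] : StandardBorelSpace (ProbabilityMeasure X) := by
  obtain ⟨e₀, he₀⟩ := exists_measurableEmbedding_real X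
  let e : X → EReal := fun x => (e₀ x : EReal)
  have he : MeasurableEmbedding e := EReal.measurableEmbedding_coe.comp he₀
  let : MetricSpace (ProbabilityMeasure EReal) := metrizableSpaceMetric _
  let R : Set (ProbabilityMeasure EReal) := {ν | (ν : Measure EReal) (Set.range e) = 1}
  have hR : MeasurableSet R :=
    ((Measure.measurable_coe he.measurableSet_range).comp measurable_subtype_coe)
      (measurableSet_singleton 1)
  have := hR.standardBorel
  refine standardBorelSpace_of_measurableEquiv (β := R) ?_
  refine
    { toFun := fun μ => ⟨μ.map he.measurable.aemeasurable, ?_⟩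
      invFun := fun ν => ⟨(ν.1 : Measure EReal).comap e, ⟨?_⟩⟩
      left_inv := ?_
      right_inv := ?_
      measurable_toFun := ?_
      measurable_invFun := ?_ }
  · simp only [R, Set.mem_ofPred_eq, ProbabilityMeasure.toMeasure_map]
    rw [Measure.map_apply he.measurable he.measurableSet_range]
    simp
  · rw [he.comap_apply, Set.image_univ]
    exact ν.2
  · intro μ
    exact Subtype.ext (he.comap_map _)
  · intro ν
    refine Subtype.ext (Subtype.ext ?_)
    refine (he.map_comap _).trans ?_
    refine Measure.restrict_eq_self_of_ae_mem ?_
    have h1 : (ν.1 : Measure EReal) (Set.range e) = 1 := ν.2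
    exact (prob_compl_eq_zero_iff he.measurableSet_range).2 h1
  · exact (((Measure.measurable_map e he.measurable).comp
      measurable_subtype_coe).subtype_mk).subtype_mk
  · refine Measurable.subtype_mk ?_
    refine Measure.measurable_of_measurable_coe _ fun s hs => ?_
    simp only [he.comap_apply]
    exact (Measure.measurable_coe (he.measurableSet_image' hs)).comp
      (measurable_subtype_coe.comp measurable_subtype_coe)

end ProbabilityMeasureSpaces

noncomputable section

/-! ### Adapted processes -/

/-- An adapted stochastic process in discrete time `{0, 1, …, T}` with state space `U`: a filtered
probability space together with a process on it whose value at time `t` is `ℱ t`-measurable.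
Different processes may live on different filtered probability spaces. -/
structure AdaptedProcess (T : ℕ) (U : Type v) [MeasurableSpace U] : Type (max (u + 1) v) where
  /-- the sample space -/
  Ω : Type u
  /-- the σ-algebra of the sample space -/
  [mΩ : MeasurableSpace Ω]
  /-- the probability measure -/
  P : Measure Ω
  [isProbabilityMeasure : IsProbabilityMeasure P]
  /-- the filtration -/
  ℱ : Filtration (Fin (T + 1)) mΩ
  /-- the process -/
  X : Fin (T + 1) → Ω → U
  adapted : Adapted ℱ X

attribute [instance] AdaptedProcess.mΩ AdaptedProcess.isProbabilityMeasure

namespace AdaptedProcess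

variable {T : ℕ} {U : Type v}

/-- The path of the process at the sample point `ω`. -/
def path [MeasurableSpace U] (A : AdaptedProcess.{u, v} T U) (ω : A.Ω) : Fin (T + 1) → U :=
  fun t => A.X t ω

theorem nonempty_path [MeasurableSpace U] (A : AdaptedProcess.{u, v} T U) :
    Nonempty (Fin (T + 1) → U) :=
  A.P.nonempty_of_neZero.map A.path

/-- A regular version of `ℙ(X ∈ · | ℱ_t)`, the conditional law of the whole path given the
information at time `t`: the regular conditional distribution of the path given the identity map
from the sample space to the sample space equipped with the σ-algebra `ℱ_t`. -/
def condLaw [MeasurableSpace U] [StandardBorelSpace U] (A : AdaptedProcess.{u, v} T U)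
    (t : Fin (T + 1)) : @Kernel A.Ω (Fin (T + 1) → U) (A.ℱ t) _ :=
  have := A.nonempty_path
  @condDistrib A.Ω A.Ω (Fin (T + 1) → U) _ _ _ A.mΩ (A.ℱ t) A.path id A.P _

instance [MeasurableSpace U] [StandardBorelSpace U] (A : AdaptedProcess.{u, v} T U)
    (t : Fin (T + 1)) (ω : A.Ω) : IsProbabilityMeasure (A.condLaw t ω) := by
  have := A.nonempty_path
  unfold condLaw
  infer_instance

/-- The prediction process `t ↦ ℙ(X ∈ · | ℱ_t)` of an adapted process, an adapted process on the
same filtered probability space whose states are laws on path space. -/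
def prediction [MeasurableSpace U] [StandardBorelSpace U] (A : AdaptedProcess.{u, v} T U) :
    AdaptedProcess.{u, v} T (ProbabilityMeasure (Fin (T + 1) → U)) where
  Ω := A.Ω
  P := A.P
  ℱ := A.ℱ
  X t ω := ⟨A.condLaw t ω, inferInstance⟩
  adapted t := (A.condLaw t).measurable.subtype_mk

/-- The values of the prediction process are conditional probabilities of the path. -/
theorem prediction_ae_eq_condExp [MeasurableSpace U] [StandardBorelSpace U]
    (A : AdaptedProcess.{u, v} T U) (t : Fin (T + 1)) {B : Set (Fin (T + 1) → U)}
    (hB : MeasurableSet B) :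
    (fun ω => (A.prediction.X t ω : Measure (Fin (T + 1) → U)).real B) =ᵐ[A.P]
      A.P⟦A.path ⁻¹' B | A.ℱ t⟧ := by
  have := A.nonempty_path
  have hpath : Measurable A.path := measurable_pi_lambda _ fun s => A.adapted.measurable
  have h := @condDistrib_ae_eq_condExp A.Ω A.Ω (Fin (T + 1) → U) _ _ _ A.mΩ A.P _ id A.path
    (A.ℱ t) B (measurable_id'' (A.ℱ.le t)) hpath hB
  rwa [MeasurableSpace.comap_id] at h

end AdaptedProcess

/-! ### Prediction processes of higher rank -/

/-- A separable metrizable space with its Borel σ-algebra, which is moreover standard Borel. -/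
structure StateSpace : Type (v + 1) where
  carrier : Type v
  [top : TopologicalSpace carrier]
  [meas : MeasurableSpace carrier]
  [secondCountable : SecondCountableTopology carrier]
  [metrizable : MetrizableSpace carrier]
  [borel : BorelSpace carrier]
  [standardBorel : StandardBorelSpace carrier]

instance : CoeSort StateSpace.{v} (Type v) := ⟨StateSpace.carrier⟩

attribute [instance] StateSpace.top StateSpace.meas StateSpace.secondCountable
  StateSpace.metrizable StateSpace.borel StateSpace.standardBorel

/-- The state space of the prediction process of rank `r`, that is, the space of rank `r`
probability measures on `U`: it is `U` for `r = 0`, and for `r + 1` it is the space of probability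
measures on paths `{0, …, T} → rankSpace T U r`, with the topology of weak convergence. -/
def rankSpace (T : ℕ) (U : Type v) [TopologicalSpace U] [PolishSpace U] [MeasurableSpace U]
    [BorelSpace U] : ℕ → StateSpace.{v}
  | 0 => ⟨U⟩
  | r + 1 => ⟨ProbabilityMeasure (Fin (T + 1) → rankSpace T U r)⟩

variable {T : ℕ} {U : Type v} [TopologicalSpace U] [PolishSpace U] [MeasurableSpace U]
  [BorelSpace U]

/-- The prediction process of rank `r`: the process itself for `r = 0`, and the prediction process
of the rank `r` prediction process for `r + 1`. -/
def AdaptedProcess.predictionOfRank (A : AdaptedProcess.{u, v} T U) :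
    (r : ℕ) → AdaptedProcess.{u, v} T (rankSpace T U r)
  | 0 => A
  | r + 1 => (A.predictionOfRank r).prediction

/-! ### Adapted functionals -/

/-- Adapted functionals, built in three ways: from bounded continuous functions of finitely many
values of the process, by composing finitely many adapted functionals with a bounded continuous
function, and by taking the conditional expectation at some time `t`. -/
inductive AdaptedFunctional (T : ℕ) (U : Type v) [TopologicalSpace U] : Type v
  | base (n : ℕ) (t : Fin n → Fin (T + 1)) (g : (Fin n → U) →ᵇ ℝ) : AdaptedFunctional T U
  | comp (n : ℕ) (f : Fin n → AdaptedFunctional T U) (g : (Fin n → ℝ) →ᵇ ℝ) :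
      AdaptedFunctional T U
  | condExp (f : AdaptedFunctional T U) (t : Fin (T + 1)) : AdaptedFunctional T U

namespace AdaptedFunctional

/-- The random variable `f(A)`, defined up to almost sure equality. -/
def eval {T : ℕ} {U : Type v} [TopologicalSpace U] [MeasurableSpace U]
    (A : AdaptedProcess.{u, v} T U) : AdaptedFunctional T U → A.Ω → ℝ
  | base _ t g => fun ω => g fun i => A.X (t i) ω
  | comp _ f g => fun ω => g fun i => (f i).eval A ω
  | condExp f t => A.P[f.eval A | A.ℱ t]

/-- The rank of an adapted functional: the number of nested conditional expectations. -/
def rank {T : ℕ} {U : Type v} [TopologicalSpace U] : AdaptedFunctional T U → ℕ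
  | base _ _ _ => 0
  | comp _ f _ => Finset.univ.sup fun i => (f i).rank
  | condExp f _ => f.rank + 1

end AdaptedFunctional

/-! ### The two topologies of rank `r` -/

/-- The expectation `𝔼[f(A)]` of an adapted functional. -/
def adaptedExpectation {T : ℕ} {U : Type v} [TopologicalSpace U] [MeasurableSpace U]
    (f : AdaptedFunctional T U) (A : AdaptedProcess.{u, v} T U) : ℝ :=
  ∫ ω, f.eval A ω ∂A.P

/-- The expectation of a bounded continuous function of the path of the rank `r` prediction
process. -/
def predictionExpectation (r : ℕ) (f : (Fin (T + 1) → rankSpace T U r) →ᵇ ℝ)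
    (A : AdaptedProcess.{u, v} T U) : ℝ :=
  ∫ ω, f ((A.predictionOfRank r).path ω) ∂(A.predictionOfRank r).P

/-- Convergence of a sequence of processes in the adapted topology of rank `r`. -/
def ConvergesAdapted (r : ℕ) (A : ℕ → AdaptedProcess.{u, v} T U) (B : AdaptedProcess.{u, v} T U) :
    Prop :=
  ∀ f : AdaptedFunctional T U, f.rank ≤ r →
    Tendsto (fun n => adaptedExpectation f (A n)) atTop (𝓝 (adaptedExpectation f B))

/-- Convergence of a sequence of processes in the extended weak topology of rank `r`: the rank `r`
prediction processes converge in law, as random paths. -/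
def ConvergesExtendedWeak (r : ℕ) (A : ℕ → AdaptedProcess.{u, v} T U)
    (B : AdaptedProcess.{u, v} T U) : Prop :=
  ∀ f : (Fin (T + 1) → rankSpace T U r) →ᵇ ℝ,
    Tendsto (fun n => predictionExpectation r f (A n)) atTop (𝓝 (predictionExpectation r f B))

variable (T U) in
/-- The adapted topology of rank `r` on the adapted processes: the initial topology of the maps
`A ↦ 𝔼[f(A)]`, where `f` ranges over the adapted functionals of rank at most `r`. -/
abbrev adaptedTopology (r : ℕ) : TopologicalSpace (AdaptedProcess.{u, v} T U) :=
  ⨅ f : {f : AdaptedFunctional T U // f.rank ≤ r},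
    TopologicalSpace.induced (adaptedExpectation f.1) inferInstance

variable (T U) in
/-- The extended weak topology of rank `r` on the adapted processes: the initial topology of the
maps which send a process to the expectation of a bounded continuous function of its rank `r`
prediction process. -/
abbrev extendedWeakTopology (r : ℕ) : TopologicalSpace (AdaptedProcess.{u, v} T U) :=
  ⨅ f : (Fin (T + 1) → rankSpace T U r) →ᵇ ℝ,
    TopologicalSpace.induced (predictionExpectation r f) inferInstance

theorem tendsto_adaptedTopology_iff {T : ℕ} {W : Type v} [TopologicalSpace W] [MeasurableSpace W]
    {r : ℕ} {A : ℕ → AdaptedProcess.{u, v} T W} {B : AdaptedProcess.{u, v} T W} :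
    Tendsto A atTop (@nhds _ (adaptedTopology T W r) B) ↔ ConvergesAdapted r A B := by
  unfold adaptedTopology
  rw [nhds_iInf]
  simp only [nhds_induced, tendsto_iInf, tendsto_comap_iff, ConvergesAdapted, Subtype.forall]
  rfl

theorem tendsto_extendedWeakTopology_iff {r : ℕ} {A : ℕ → AdaptedProcess.{u, v} T U}
    {B : AdaptedProcess.{u, v} T U} :
    Tendsto A atTop (@nhds _ (extendedWeakTopology T U r) B) ↔ ConvergesExtendedWeak r A B := by
  unfold extendedWeakTopology
  rw [nhds_iInf]
  simp only [nhds_induced, tendsto_iInf, tendsto_comap_iff, ConvergesExtendedWeak]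
  rfl

end

/-!
An adapted functional of rank at most `k` is almost surely a bounded continuous function of the path
of the rank `k` prediction process: conditional expectations are integrals against the next
prediction process, and the value at time `t` can be read off continuously from the prediction at
time `t`, whose marginal at time `t` is a Dirac mass. Hence the extended weak topology is finer.

Conversely, the functions of the rank `k` path obtained in this way determine convergence in law, on
every Polish space. They are closed under composition with continuous functions, so it is enough
that they induce the topology of the path space: they then approximate every bounded continuous
function from below, and its negative as well. By induction on `k`, if they determine convergence at
rank `k`, then the maps `μ ↦ ∫ F dμ_t`, which represent conditional expectations, induce the
topology of the path space at rank `k + 1`.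
-/

noncomputable section

section StrongSeparation

variable {E : Type*} [TopologicalSpace E] {𝒮 : Set (E →ᵇ ℝ)}

/-- A set of bounded continuous functions strongly separates points, in the sense of Ethier and
Kurtz, if the topology of the space is the initial topology of these functions. This is not
`Set.SeparatesPointsStrongly`, which prescribes the values at two points. -/
def StronglySeparatesPoints (𝒮 : Set (E →ᵇ ℝ)) : Prop :=
  IsInducing fun (x : E) (F : 𝒮) => F.1 x

theorem stronglySeparatesPoints_univ [CompletelyRegularSpace E] :
    StronglySeparatesPoints (Set.univ : Set (E →ᵇ ℝ)) := by
  refine isInducing_iff_nhds.2 fun x => le_antisymm ?_ fun U hU => ?_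
  · exact (continuous_pi fun F : (Set.univ : Set (E →ᵇ ℝ)) => F.1.continuous).tendsto x |>.le_comap
  · obtain ⟨V, hVU, hV, hxV⟩ := mem_nhds_iff.1 hU
    obtain ⟨f, hf, hfx, hfV⟩ := CompletelyRegularSpace.completely_regular_isOpen x V hV hxV
    let F : E →ᵇ ℝ := BoundedContinuousFunction.mkOfBound ⟨fun y => f y, by fun_prop⟩ 1
      fun y z => Real.dist_le_of_mem_Icc_01 (f y).2 (f z).2
    refine mem_comap.2 ⟨{v | v ⟨F, trivial⟩ < 1}, ?_, fun y hy => hVU ?_⟩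
    · exact (isOpen_Iio.preimage (continuous_apply _)).mem_nhds (by simp [F, hfx])
    · by_contra hyV
      simp [F, hfV hyV] at hy

/-- Closure of a set of bounded continuous functions under composing finitely many of its members
with a continuous function; as a relation, since the outer function need not be bounded. -/
def ClosedUnderContinuousComp (𝒮 : Set (E →ᵇ ℝ)) : Prop :=
  ∀ ⦃n : ℕ⦄ (h : C(Fin n → ℝ, ℝ)) ⦃F : Fin n → E →ᵇ ℝ⦄, (∀ i, F i ∈ 𝒮) →
    ∀ ⦃G : E →ᵇ ℝ⦄, (∀ x, G x = h fun i => F i x) → G ∈ 𝒮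

namespace ClosedUnderContinuousComp

theorem const_mem (h𝒮 : ClosedUnderContinuousComp 𝒮) (c : ℝ) :
    BoundedContinuousFunction.const E c ∈ 𝒮 :=
  h𝒮 (.const (Fin 0 → ℝ) c) (F := ![]) (fun i => i.elim0) fun _ => rfl

theorem map_mem (h𝒮 : ClosedUnderContinuousComp 𝒮) {φ : ℝ → ℝ} (hφ : Continuous φ) {F G : E →ᵇ ℝ}
    (hF : F ∈ 𝒮) (hG : ∀ x, G x = φ (F x)) : G ∈ 𝒮 :=
  h𝒮 (n := 1) ⟨fun y => φ (y 0), by fun_prop⟩ (fun _ => hF) hG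

theorem map₂_mem (h𝒮 : ClosedUnderContinuousComp 𝒮) {φ : ℝ → ℝ → ℝ}
    (hφ : Continuous (Function.uncurry φ)) {F G H : E →ᵇ ℝ} (hF : F ∈ 𝒮) (hG : G ∈ 𝒮)
    (hH : ∀ x, H x = φ (F x) (G x)) : H ∈ 𝒮 :=
  h𝒮 (n := 2) (F := ![F, G]) ⟨fun y => φ (y 0) (y 1), by fun_prop⟩
    (Fin.forall_fin_two.2 ⟨hF, hG⟩) hH

theorem partialSups_mem (h𝒮 : ClosedUnderContinuousComp 𝒮) {F : ℕ → E →ᵇ ℝ} (hF : ∀ n, F n ∈ 𝒮)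
    (n : ℕ) : partialSups F n ∈ 𝒮 := by
  induction n with
  | zero => simpa using hF 0
  | succ n ih =>
    rw [partialSups_add_one]
    exact h𝒮.map₂_mem (φ := max) (by fun_prop) ih (hF (n + 1)) fun _ => rfl

/-- The filter of the sets whose complement can be separated from `x` by a function of `𝒮`. -/
def separationFilter (h𝒮 : ClosedUnderContinuousComp 𝒮) (x : E) : Filter E where
  sets := {U | ∃ b ∈ 𝒮, b x = 1 ∧ (∀ y, b y ∈ Set.Icc (0 : ℝ) 1) ∧ ∀ y ∉ U, b y = 0}
  univ_sets := ⟨_, h𝒮.const_mem 1, rfl, fun _ => by simp, fun y hy => (hy trivial).elim⟩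
  sets_of_superset := fun ⟨b, hb, hbx, hb01, hbU⟩ hUV =>
    ⟨b, hb, hbx, hb01, fun y hy => hbU y fun h => hy (hUV h)⟩
  inter_sets := fun ⟨b, hb, hbx, hb01, hbU⟩ ⟨c, hc, hcx, hc01, hcV⟩ => by
    refine ⟨b * c, h𝒮.map₂_mem continuous_mul hb hc fun _ => rfl, by simp [hbx, hcx],
      fun y => unitInterval.mul_mem (hb01 y) (hc01 y), fun y hy => ?_⟩
    rcases not_and_or.1 hy with hU | hV
    · simp [hbU y hU]
    · simp [hcV y hV]

theorem separationFilter_le_nhds (h𝒮 : ClosedUnderContinuousComp 𝒮)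
    (hsep : StronglySeparatesPoints 𝒮) (x : E) : h𝒮.separationFilter x ≤ 𝓝 x := by
  refine tendsto_id'.1 (hsep.tendsto_nhds_iff.2 (tendsto_pi_nhds.2 fun F V hV => ?_))
  obtain ⟨W, hWV, hW, hxW⟩ := mem_nhds_iff.1 hV
  obtain ⟨φ, hφW, hφx, hφ01⟩ := exists_bounded_zero_one_of_closed hW.isClosed_compl
    (isClosed_singleton (x := F.1 x)) (Set.disjoint_compl_left_iff_subset.2 (by simpa using hxW))
  exact ⟨φ.compContinuous F.1, h𝒮.map_mem φ.continuous F.2 fun _ => rfl, hφx rfl,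
    fun y => hφ01 _, fun y hy => hφW fun h => hy (hWV h)⟩

theorem exists_mem_le_sub_lt (h𝒮 : ClosedUnderContinuousComp 𝒮) (hsep : StronglySeparatesPoints 𝒮)
    (f : E →ᵇ ℝ) (x : E) {ε : ℝ} (hε : 0 < ε) : ∃ H ∈ 𝒮, H ≤ f ∧ f x - ε < H x := by
  have hU : {y | f x - ε / 2 < f y} ∈ 𝓝 x :=
    f.continuous.continuousAt.eventually (lt_mem_nhds (by linarith))
  obtain ⟨b, hb, hbx, hb01, hbU⟩ := h𝒮.separationFilter_le_nhds hsep x hU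
  let H : E →ᵇ ℝ := .const E (-‖f‖) + (f x - ε / 2 + ‖f‖) • b
  have hH : ∀ y, H y = -‖f‖ + (f x - ε / 2 + ‖f‖) * b y := fun _ => rfl
  refine ⟨H, h𝒮.map_mem (φ := fun s => -‖f‖ + (f x - ε / 2 + ‖f‖) * s) (by fun_prop) hb hH,
    fun y => ?_, by rw [hH, hbx]; linarith⟩
  change H y ≤ f y
  have hf : -‖f‖ ≤ f y := f.neg_norm_le_apply y
  rw [hH]
  by_cases hy : f x - ε / 2 < f y
  · nlinarith [(hb01 y).1, (hb01 y).2]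
  · simpa [hbU y hy] using hf

theorem exists_seq_le_forall_exists_sub_lt [LindelofSpace E] [Nonempty E]
    (h𝒮 : ClosedUnderContinuousComp 𝒮) (hsep : StronglySeparatesPoints 𝒮) (f : E →ᵇ ℝ) {ε : ℝ}
    (hε : 0 < ε) : ∃ H : ℕ → E →ᵇ ℝ, (∀ n, H n ∈ 𝒮 ∧ H n ≤ f) ∧ Monotone H ∧
      ∀ x, ∃ n, f x - ε < H n x := by
  choose H hH𝒮 hHf hH using fun x => h𝒮.exists_mem_le_sub_lt hsep f x hε
  obtain ⟨t, ht, htU⟩ := LindelofSpace.elim_nhds_subcover (fun x => {y | f y - ε < H x y})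
    fun x => (isOpen_lt (by fun_prop) (by fun_prop)).mem_nhds (hH x)
  have ht₀ : t.Nonempty := by
    rw [Set.nonempty_iff_ne_empty]
    rintro rfl
    exact Set.empty_ne_univ (by simpa using htU)
  obtain ⟨u, rfl⟩ := ht.exists_eq_range ht₀
  refine ⟨partialSups fun n => H (u n), fun n => ⟨h𝒮.partialSups_mem (fun n => hH𝒮 (u n)) n,
    partialSups_le _ _ _ fun i _ => hHf (u i)⟩, (partialSups _).monotone, fun x => ?_⟩
  obtain ⟨n, hn⟩ : ∃ n, f x - ε < H (u n) x := by simpa using htU.ge (Set.mem_univ x)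
  exact ⟨n, hn.trans_le (le_partialSups (fun n => H (u n)) n x)⟩

variable [MeasurableSpace E] [OpensMeasurableSpace E] [LindelofSpace E]

theorem exists_mem_le_integral_sub_lt (h𝒮 : ClosedUnderContinuousComp 𝒮)
    (hsep : StronglySeparatesPoints 𝒮) (f : E →ᵇ ℝ) (μ : ProbabilityMeasure E) {ε : ℝ}
    (hε : 0 < ε) : ∃ H ∈ 𝒮, H ≤ f ∧ ∫ x, f x ∂(μ : Measure E) - ε < ∫ x, H x ∂(μ : Measure E) := by
  have := μ.nonempty
  obtain ⟨H, hHf, hmono, hH⟩ := h𝒮.exists_seq_le_forall_exists_sub_lt hsep f (half_pos hε)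
  let g : E →ᵇ ℝ := f - .const E (ε / 2)
  have hlim : Tendsto (fun n => ∫ x, (H n ⊓ g) x ∂(μ : Measure E)) atTop
      (𝓝 (∫ x, g x ∂(μ : Measure E))) := by
    refine integral_tendsto_of_tendsto_of_monotone (fun n => (H n ⊓ g).integrable _)
      (g.integrable _) (Eventually.of_forall fun x m n hmn => ?_)
      (Eventually.of_forall fun x => ?_)
    · exact inf_le_inf_right g (hmono hmn) x
    · obtain ⟨N, hN⟩ := hH x
      refine tendsto_const_nhds.congr' ((eventually_ge_atTop N).mono fun n hn => ?_)
      exact (min_eq_right (hN.le.trans (hmono hn x))).symm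
  have hg : ∫ x, f x ∂(μ : Measure E) - ε < ∫ x, g x ∂(μ : Measure E) := by
    have : ∫ x, g x ∂(μ : Measure E) = ∫ x, f x ∂(μ : Measure E) - ε / 2 := by
      change ∫ x, (f x - ε / 2) ∂(μ : Measure E) = _
      simp [integral_sub (f.integrable (μ : Measure E)) (integrable_const (ε / 2))]
    linarith
  obtain ⟨n, hn⟩ := (hlim.eventually (lt_mem_nhds hg)).exists
  exact ⟨H n, (hHf n).1, (hHf n).2, hn.trans_le <|
    integral_mono ((H n ⊓ g).integrable _) ((H n).integrable _) fun x => min_le_left _ _⟩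

end ClosedUnderContinuousComp

variable [MeasurableSpace E] [OpensMeasurableSpace E]

/-- A set of bounded continuous functions is convergence determining if the topology of weak
convergence is the initial topology of the integrals of these functions. -/
def IsConvergenceDetermining (𝒮 : Set (E →ᵇ ℝ)) : Prop :=
  IsInducing fun (μ : ProbabilityMeasure E) (F : 𝒮) => ∫ x, F.1 x ∂(μ : Measure E)

theorem StronglySeparatesPoints.isConvergenceDetermining [LindelofSpace E]
    (hsep : StronglySeparatesPoints 𝒮) (h𝒮 : ClosedUnderContinuousComp 𝒮) :
    IsConvergenceDetermining 𝒮 := by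
  refine isInducing_iff_nhds.2 fun μ => le_antisymm ?_ (tendsto_id'.1 ?_)
  · exact ((continuous_pi fun F : 𝒮 =>
      ProbabilityMeasure.continuous_integral_boundedContinuousFunction F.1).tendsto μ).le_comap
  set L := comap (fun (ν : ProbabilityMeasure E) (F : 𝒮) => ∫ x, F.1 x ∂(ν : Measure E))
    (𝓝 fun F => ∫ x, F.1 x ∂(μ : Measure E))
  have hlower : ∀ f : E →ᵇ ℝ, ∀ c < ∫ x, f x ∂(μ : Measure E),
      ∀ᶠ ν : ProbabilityMeasure E in L, c < ∫ x, f x ∂(ν : Measure E) := fun f c hc => by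
    obtain ⟨H, hH, hHf, hcH⟩ := h𝒮.exists_mem_le_integral_sub_lt hsep f μ (sub_pos.2 hc)
    have hHL := (tendsto_pi_nhds.1 tendsto_comap ⟨H, hH⟩ : Tendsto _ L _)
    filter_upwards [hHL.eventually (lt_mem_nhds (by simpa using hcH))] with ν hν
    exact hν.trans_le (integral_mono (H.integrable _) (f.integrable _) hHf)
  refine ProbabilityMeasure.tendsto_iff_forall_integral_tendsto.2 fun f =>
    tendsto_order.2 ⟨hlower f, fun c hc => ?_⟩
  filter_upwards [hlower (-f) (-c) (by simpa [integral_neg] using hc)] with ν hν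
  simpa [integral_neg] using hν

end StrongSeparation

section ProductSpaces

variable {ι : Type*} {E : Type*} [TopologicalSpace E] [MeasurableSpace E] [OpensMeasurableSpace E]

/-- The bounded continuous function `μ ↦ ∫ F dμ` on the space of probability measures. -/
def integralBCF (F : E →ᵇ ℝ) : ProbabilityMeasure E →ᵇ ℝ :=
  BoundedContinuousFunction.ofNormedAddCommGroup (fun μ => ∫ x, F x ∂(μ : Measure E))
    (ProbabilityMeasure.continuous_integral_boundedContinuousFunction F) ‖F‖ fun μ =>
      F.norm_integral_le_norm (μ : Measure E)

/-- The bounded continuous function `μ ↦ ∫ F dμᵢ` of a family of probability measures. -/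
def coordIntegralBCF (F : E →ᵇ ℝ) (i : ι) : (ι → ProbabilityMeasure E) →ᵇ ℝ :=
  (integralBCF F).compContinuous ⟨fun μ => μ i, continuous_apply i⟩

theorem IsConvergenceDetermining.stronglySeparatesPoints_pi {𝒮 : Set (E →ᵇ ℝ)}
    {𝒯 : Set ((ι → ProbabilityMeasure E) →ᵇ ℝ)} (h𝒮 : IsConvergenceDetermining 𝒮)
    (h : ∀ F ∈ 𝒮, ∀ i, coordIntegralBCF F i ∈ 𝒯) : StronglySeparatesPoints 𝒯 := by
  have hpi : IsInducing fun (μ : ι → ProbabilityMeasure E) (i : ι) (F : 𝒮) =>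
      ∫ x, F.1 x ∂(μ i : Measure E) := .piMap fun _ => h𝒮
  let restrict (v : 𝒯 → ℝ) (i : ι) (F : 𝒮) : ℝ := v ⟨coordIntegralBCF F.1 i, h F.1 F.2 i⟩
  exact IsInducing.of_comp (g := restrict) (continuous_pi fun F => F.1.continuous) (by fun_prop) hpi

end ProductSpaces

section Diagonal

variable {ι : Type*} [Fintype ι] {E : ι → Type*} [∀ i, TopologicalSpace (E i)]
  [∀ i, SecondCountableTopology (E i)] [∀ i, MetrizableSpace (E i)] [∀ i, MeasurableSpace (E i)]
  [∀ i, BorelSpace (E i)]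

theorem continuous_pi_map_eval :
    Continuous fun μ : ι → ProbabilityMeasure (∀ i, E i) =>
      ProbabilityMeasure.pi fun i => (μ i).map (measurable_pi_apply i).aemeasurable :=
  ProbabilityMeasure.continuous_pi.comp <| continuous_pi fun i =>
    (ProbabilityMeasure.continuous_map (continuous_apply i)).comp (continuous_apply i)

/-- The integral of `F` against the product of the diagonal marginals of a family `μ` of laws on
path space, the `i`-th factor being the law under `μ i` of the value at `i`. -/
def diagonalBCF (F : (∀ i, E i) →ᵇ ℝ) : (ι → ProbabilityMeasure (∀ i, E i)) →ᵇ ℝ :=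
  (integralBCF F).compContinuous ⟨_, continuous_pi_map_eval⟩

theorem diagonalBCF_eq_of_map_eval_eq_dirac (F : (∀ i, E i) →ᵇ ℝ)
    {μ : ι → ProbabilityMeasure (∀ i, E i)} {x : ∀ i, E i}
    (h : ∀ i, (μ i : Measure (∀ i, E i)).map (fun y => y i) = Measure.dirac (x i)) :
    diagonalBCF F μ = F x := by
  change ∫ y, F y ∂(Measure.pi fun i => (μ i : Measure (∀ i, E i)).map (fun y => y i)) = F x
  simp_rw [h]
  rw [← Measure.infinitePi_eq_pi, Measure.infinitePi_dirac, integral_dirac]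

end Diagonal

theorem ae_condDistrib_map_eq_dirac {Ω β E E' : Type*} {mΩ : MeasurableSpace Ω}
    {mβ : MeasurableSpace β} [MeasurableSpace E] [StandardBorelSpace E] [Nonempty E]
    [MeasurableSpace E'] [StandardBorelSpace E'] [Nonempty E'] {μ : Measure Ω} [IsFiniteMeasure μ]
    {X : Ω → β} {Y : Ω → E} (hX : AEMeasurable X μ) (hY : AEMeasurable Y μ) {f : E → E'}
    {g : β → E'} (hf : Measurable f) (hg : Measurable g) (hfg : f ∘ Y =ᵐ[μ] g ∘ X) :
    ∀ᵐ ω ∂μ, (condDistrib Y X μ (X ω)).map f = Measure.dirac (g (X ω)) := by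
  have hmap : (condDistrib Y X μ).map f =ᵐ[μ.map X] Kernel.deterministic g hg :=
    (condDistrib_comp X hY hf).symm.trans <|
      (condDistrib_congr_left hfg).symm ▸ condDistrib_comp_self X hg
  filter_upwards [ae_of_ae_map hX hmap] with ω hω
  rwa [Kernel.map_apply _ hf, Kernel.deterministic_apply] at hω

namespace AdaptedProcess

section Prediction

variable {T : ℕ} {U : Type v} [MeasurableSpace U]

theorem measurable_path (A : AdaptedProcess.{u, v} T U) : Measurable A.path :=
  measurable_pi_lambda _ fun s => (A.adapted s).mono (A.ℱ.le s) le_rfl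

/-- The law of an adapted process on path space. -/
def law (A : AdaptedProcess.{u, v} T U) : ProbabilityMeasure (Fin (T + 1) → U) :=
  ⟨A.P.map A.path, Measure.isProbabilityMeasure_map A.measurable_path.aemeasurable⟩

variable [StandardBorelSpace U]

theorem condExp_comp_path_ae_eq (A : AdaptedProcess.{u, v} T U) (t : Fin (T + 1))
    {F : (Fin (T + 1) → U) → ℝ} (hF : StronglyMeasurable F)
    (hint : Integrable (fun ω => F (A.path ω)) A.P) :
    A.P[fun ω => F (A.path ω) | A.ℱ t] =ᵐ[A.P]
      fun ω => ∫ x, F x ∂(A.prediction.X t ω : Measure (Fin (T + 1) → U)) := by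
  have := A.nonempty_path
  have h := @condExp_ae_eq_integral_condDistrib A.Ω A.Ω (Fin (T + 1) → U) ℝ _ _ _ _ A.mΩ A.P _
    id A.path (A.ℱ t) _ _ (measurable_id'' (A.ℱ.le t)) A.measurable_path.aemeasurable F hF hint
  rwa [MeasurableSpace.comap_id] at h

theorem prediction_map_eval_ae_eq_dirac (A : AdaptedProcess.{u, v} T U) (t : Fin (T + 1)) :
    ∀ᵐ ω ∂A.P, (A.prediction.X t ω : Measure (Fin (T + 1) → U)).map (fun x => x t) =
      Measure.dirac (A.X t ω) := by
  have := A.nonempty_path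
  have hU : Nonempty U := this.map fun x => x t
  have hid : @AEMeasurable _ _ (A.ℱ t) A.mΩ id A.P :=
    @Measurable.aemeasurable _ _ A.mΩ (A.ℱ t) _ _ (measurable_id'' (A.ℱ.le t))
  exact @ae_condDistrib_map_eq_dirac A.Ω A.Ω (Fin (T + 1) → U) U A.mΩ (A.ℱ t) _ _ _ _ _ _ A.P _
    id A.path hid A.measurable_path.aemeasurable (fun x => x t) (A.X t)
    (measurable_pi_apply t) (A.adapted t) .rfl

end Prediction

/-- The filtered probability space of `A` with another process on it. -/
abbrev withX {T : ℕ} {U W : Type*} [MeasurableSpace U] [MeasurableSpace W]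
    (A : AdaptedProcess T U) (X : {X : Fin (T + 1) → A.Ω → W // Adapted A.ℱ X}) :
    AdaptedProcess T W :=
  { Ω := A.Ω, P := A.P, ℱ := A.ℱ, X := X.1, adapted := X.2 }

variable {T : ℕ} {U : Type v} [TopologicalSpace U] [PolishSpace U] [MeasurableSpace U]
  [BorelSpace U]

/-- The rank `k` prediction process as a process on the sample space of `A`. The sample space of
`A.predictionOfRank k` is equal to that of `A`, but for a variable `k` not definitionally so. -/
def rankPrediction (A : AdaptedProcess.{u, v} T U) :
    (k : ℕ) → {X : Fin (T + 1) → A.Ω → rankSpace T U k // Adapted A.ℱ X}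
  | 0 => ⟨A.X, A.adapted⟩
  | k + 1 =>
    let B := (A.withX (A.rankPrediction k)).prediction
    ⟨B.X, B.adapted⟩

/-- The filtered probability space of `A` with the rank `k` prediction process. -/
abbrev withRank (A : AdaptedProcess.{u, v} T U) (k : ℕ) :
    AdaptedProcess.{u, v} T (rankSpace T U k) :=
  A.withX (A.rankPrediction k)

theorem predictionOfRank_eq_withRank (A : AdaptedProcess.{u, v} T U) (k : ℕ) :
    A.predictionOfRank k = A.withRank k := by
  induction k with
  | zero => rfl
  | succ k ih => exact congrArg prediction ih

theorem predictionExpectation_eq_integral_law {k : ℕ}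
    (F : (Fin (T + 1) → rankSpace T U k) →ᵇ ℝ) (A : AdaptedProcess.{u, v} T U) :
    predictionExpectation k F A = ∫ x, F x ∂((A.predictionOfRank k).law : Measure _) :=
  (integral_map (A.predictionOfRank k).measurable_path.aemeasurable
    F.continuous.aestronglyMeasurable).symm

end AdaptedProcess

namespace AdaptedFunctional

variable {T : ℕ} {U : Type v} [TopologicalSpace U] [PolishSpace U] [MeasurableSpace U]
  [BorelSpace U]

/-- The adapted functional `f` is almost surely the function `F` of the path of the rank `k`
prediction process. -/
def IsRepresentedBy (f : AdaptedFunctional T U) {k : ℕ}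
    (F : (Fin (T + 1) → rankSpace T U k) → ℝ) : Prop :=
  ∀ A : AdaptedProcess.{u, v} T U, f.eval A =ᵐ[A.P] fun ω => F ((A.withRank k).path ω)

namespace IsRepresentedBy

theorem adaptedExpectation_eq {f : AdaptedFunctional T U} {k : ℕ}
    {F : (Fin (T + 1) → rankSpace T U k) →ᵇ ℝ} (h : IsRepresentedBy.{u} f F) :
    adaptedExpectation.{u} f = predictionExpectation k F := by
  funext A
  rw [predictionExpectation, A.predictionOfRank_eq_withRank k]
  exact integral_congr_ae (h A)

theorem base {n : ℕ} (t : Fin n → Fin (T + 1)) (g : (Fin n → U) →ᵇ ℝ) :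
    IsRepresentedBy.{u} (.base n t g) (k := 0) fun x => g fun i => x (t i) := fun _ => .rfl

theorem comp {n : ℕ} {f : Fin n → AdaptedFunctional T U} {k : ℕ}
    {F : Fin n → (Fin (T + 1) → rankSpace T U k) → ℝ}
    (h : ∀ i, IsRepresentedBy.{u} (f i) (F i)) (g : (Fin n → ℝ) →ᵇ ℝ) :
    IsRepresentedBy.{u} (.comp n f g) fun x => g fun i => F i x := fun A => by
  filter_upwards [ae_all_iff.2 fun i => h i A] with ω hω
  exact congrArg g (funext hω)

theorem condExp {f : AdaptedFunctional T U} {k : ℕ}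
    {F : (Fin (T + 1) → rankSpace T U k) →ᵇ ℝ} (h : IsRepresentedBy.{u} f F) (t : Fin (T + 1)) :
    IsRepresentedBy.{u} (f.condExp t) (k := k + 1) (coordIntegralBCF F t) := fun A =>
  (condExp_congr_ae (h A)).trans <|
    (A.withRank k).condExp_comp_path_ae_eq t F.continuous.stronglyMeasurable <|
      (F.integrable (A.withRank k).law).comp_measurable (A.withRank k).measurable_path

theorem succ {f : AdaptedFunctional T U} {k : ℕ}
    {F : (Fin (T + 1) → rankSpace T U k) →ᵇ ℝ} (h : IsRepresentedBy.{u} f F) :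
    IsRepresentedBy.{u} f (k := k + 1) (diagonalBCF F) := fun A => by
  filter_upwards [h A, ae_all_iff.2 fun t => (A.withRank k).prediction_map_eval_ae_eq_dirac t]
    with ω hω hdirac
  exact hω.trans (diagonalBCF_eq_of_map_eval_eq_dirac F hdirac).symm

theorem exists_of_le {f : AdaptedFunctional T U} {j k : ℕ} (hjk : j ≤ k)
    {F : (Fin (T + 1) → rankSpace T U j) →ᵇ ℝ} (h : IsRepresentedBy.{u} f F) :
    ∃ G : (Fin (T + 1) → rankSpace T U k) →ᵇ ℝ, IsRepresentedBy.{u} f G := by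
  induction k, hjk using Nat.le_induction with
  | base => exact ⟨F, h⟩
  | succ k _ ih => exact ih.elim fun _ hG => ⟨_, hG.succ⟩

end IsRepresentedBy

theorem exists_isRepresentedBy (f : AdaptedFunctional T U) {k : ℕ} (hk : f.rank ≤ k) :
    ∃ F : (Fin (T + 1) → rankSpace T U k) →ᵇ ℝ, IsRepresentedBy.{u} f F := by
  induction f generalizing k with
  | base n t g =>
    let F : (Fin (T + 1) → rankSpace T U 0) →ᵇ ℝ :=
      g.compContinuous ⟨fun x i => x (t i), continuous_pi fun i => continuous_apply (t i)⟩
    exact IsRepresentedBy.exists_of_le (F := F) k.zero_le (.base t g)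
  | comp n f g ih =>
    choose F hF using fun i => ih i ((Finset.le_sup (Finset.mem_univ i)).trans hk)
    exact ⟨g.compContinuous ⟨fun x i => F i x, by fun_prop⟩, .comp hF g⟩
  | condExp f t ih =>
    obtain ⟨k, rfl⟩ := Nat.exists_eq_add_of_le' ((Nat.le_add_left 1 _).trans hk)
    obtain ⟨F, hF⟩ := ih (Nat.le_of_succ_le_succ hk)
    exact ⟨_, hF.condExp t⟩

end AdaptedFunctional

open AdaptedFunctional

section Topologies

variable {T : ℕ} {U : Type v} [TopologicalSpace U] [PolishSpace U] [MeasurableSpace U]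
  [BorelSpace U]

theorem extendedWeakTopology_le_adaptedTopology (r : ℕ) :
    extendedWeakTopology.{u, v} T U r ≤ adaptedTopology.{u, v} T U r := by
  refine le_iInf fun ⟨f, hf⟩ => ?_
  obtain ⟨F, hF⟩ := f.exists_isRepresentedBy.{u} hf
  exact hF.adaptedExpectation_eq ▸ iInf_le _ F

variable (T U) in
/-- The bounded continuous functions on the path space of the rank `k` prediction processes which
represent an adapted functional of rank at most `k`. -/
def representingFunctions (k : ℕ) : Set ((Fin (T + 1) → rankSpace T U k) →ᵇ ℝ) :=
  {F | ∃ f : AdaptedFunctional T U, f.rank ≤ k ∧ IsRepresentedBy.{u} f F}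

theorem closedUnderContinuousComp_representingFunctions (k : ℕ) :
    ClosedUnderContinuousComp (representingFunctions.{u} T U k) := by
  intro n h F hF G hG
  choose f hfk hf using hF
  -- Adapted functionals may only be composed with bounded functions, so `h` is truncated.
  let g : (Fin n → ℝ) →ᵇ ℝ := BoundedContinuousFunction.ofNormedAddCommGroup
    (fun y => max (-‖G‖) (min ‖G‖ (h y))) (by fun_prop) ‖G‖ fun y =>
      abs_le.2 ⟨le_max_left _ _, max_le (neg_le_self (norm_nonneg G)) (min_le_left _ _)⟩
  have hg : ⇑G = fun x => g fun i => F i x := funext fun x => by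
    change G x = max (-‖G‖) (min ‖G‖ (h fun i => F i x))
    rw [← hG, min_eq_right (G.apply_le_norm x), max_eq_right (G.neg_norm_le_apply x)]
  exact ⟨.comp n f g, Finset.sup_le fun i _ => hfk i, hg ▸ .comp hf g⟩

theorem stronglySeparatesPoints_representingFunctions (k : ℕ) :
    StronglySeparatesPoints (representingFunctions.{u} T U k) := by
  induction k with
  | zero =>
    have huniv : representingFunctions.{u} T U 0 = Set.univ :=
      Set.eq_univ_of_forall fun F : (Fin (T + 1) → U) →ᵇ ℝ =>
        ⟨.base (T + 1) id F, le_rfl, .base id F⟩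
    exact huniv ▸ stronglySeparatesPoints_univ
  | succ k ih =>
    have hk : IsConvergenceDetermining (representingFunctions.{u} T U k) :=
      ih.isConvergenceDetermining (closedUnderContinuousComp_representingFunctions k)
    exact hk.stronglySeparatesPoints_pi fun F ⟨f, hfk, hf⟩ t =>
      ⟨f.condExp t, Nat.succ_le_succ hfk, hf.condExp t⟩

theorem isConvergenceDetermining_representingFunctions (k : ℕ) :
    IsConvergenceDetermining (representingFunctions.{u} T U k) :=
  (stronglySeparatesPoints_representingFunctions k).isConvergenceDetermining
    (closedUnderContinuousComp_representingFunctions k)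

theorem continuous_law_predictionOfRank (k : ℕ) :
    Continuous[adaptedTopology.{u, v} T U k, inferInstance]
      fun A : AdaptedProcess.{u, v} T U => (A.predictionOfRank k).law := by
  let := adaptedTopology.{u, v} T U k
  refine (isConvergenceDetermining_representingFunctions.{u} k).continuous_iff.2
    (continuous_pi fun ⟨F, f, hfk, hf⟩ => ?_)
  have hFf : (fun A : AdaptedProcess.{u, v} T U =>
      ∫ x, F x ∂((A.predictionOfRank k).law : Measure _)) = adaptedExpectation f := by
    rw [hf.adaptedExpectation_eq]
    exact funext fun A => (A.predictionExpectation_eq_integral_law F).symm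
  exact hFf ▸ continuous_iInf_dom (i := ⟨f, hfk⟩) continuous_induced_dom

theorem adaptedTopology_le_extendedWeakTopology (r : ℕ) :
    adaptedTopology.{u, v} T U r ≤ extendedWeakTopology.{u, v} T U r := by
  refine le_iInf fun F => Continuous.le_induced ?_
  let := adaptedTopology.{u, v} T U r
  exact (funext (AdaptedProcess.predictionExpectation_eq_integral_law F)) ▸
    (ProbabilityMeasure.continuous_integral_boundedContinuousFunction F).comp
      (continuous_law_predictionOfRank r)

theorem proposition4p7_general (T : ℕ) (U : Type v) [TopologicalSpace U] [PolishSpace U]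
    [MeasurableSpace U] [BorelSpace U] (r : ℕ) :
    adaptedTopology.{u, v} T U r = extendedWeakTopology.{u, v} T U r ∧
      ∀ (A : ℕ → AdaptedProcess.{u, v} T U) (B : AdaptedProcess.{u, v} T U),
        ConvergesAdapted r A B ↔ ConvergesExtendedWeak r A B := by
  have h : adaptedTopology.{u, v} T U r = extendedWeakTopology.{u, v} T U r :=
    le_antisymm (adaptedTopology_le_extendedWeakTopology r)
      (extendedWeakTopology_le_adaptedTopology r)
  refine ⟨h, fun A B => ?_⟩
  rw [← tendsto_adaptedTopology_iff, ← tendsto_extendedWeakTopology_iff, h]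

end Topologies

end

/-- Let `V` be a separable Banach space. The extended weak topology of rank `r` on the adapted
processes with values in `V` is finer than the adapted topology of rank `r`; in particular,
convergence of sequences in the former implies convergence in the latter. For processes with values
in a compact subset `K` of `V` the two topologies coincide and have the same convergent sequences.
In Mathlib's order on topologies `s ≤ t` means that `s` is finer than `t`. -/
theorem proposition4p7 {V : Type v} [NormedAddCommGroup V] [NormedSpace ℝ V]
    [CompleteSpace V] [TopologicalSpace.SeparableSpace V] [MeasurableSpace V] [BorelSpace V]
    (T r : ℕ) :
    (extendedWeakTopology.{u, v} T V r ≤ adaptedTopology.{u, v} T V r ∧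
      ∀ (A : ℕ → AdaptedProcess.{u, v} T V) (B : AdaptedProcess.{u, v} T V),
        ConvergesExtendedWeak r A B → ConvergesAdapted r A B) ∧
    ∀ (K : Set V) [CompactSpace K],
      adaptedTopology.{u, v} T K r = extendedWeakTopology.{u, v} T K r ∧
      ∀ (A : ℕ → AdaptedProcess.{u, v} T K) (B : AdaptedProcess.{u, v} T K),
        ConvergesAdapted r A B ↔ ConvergesExtendedWeak r A B := by
  have h := proposition4p7_general.{u, v} T V r
  exact ⟨⟨h.1.ge, fun A B => (h.2 A B).2⟩, fun K _ => proposition4p7_general T K r⟩
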